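/- **Theorem (certified unlearning by SGD-D2D).** Let $\ell(z;\theta)$ be a loss on samples $z\in\mathcal Z$ and parameters $\theta\in\mathbb R^d$, and for a finite non-empty dataset $\tilde{\mathcal D}$ of samples (repetitions allowed) let $\mathcal L_{\tilde{\mathcal D}}(\theta)=\frac1{|\tilde{\mathcal D}|}\sum_{z\in\tilde{\mathcal D}}\ell(z;\theta)$. Let $L,\mu,B,C,\ell_{\theta_0}>0$ and $\theta_0\in\mathbb R^d$, and assume: 1. for all $z$, $\ell(z;\cdot)$ is differentiable and $\|\nabla\ell(z;\theta_1)-\nabla\ell(z;\theta_2)\|\le L\|\theta_1-\theta_2\|$ for all $\theta_1,\theta_2$; 2. for all $z,\theta_1,\theta_2$, $\ell(z;\theta_1)\ge\ell(z;\theta_2)+\langle\nabla\ell(z;\theta_2),\theta_1-\theta_2\rangle+\frac\mu2\|\theta_2-\theta_1\|^2$; 3. for all finite non-empty datasets $\tilde{\mathcal D}$ and all $\theta$, $\frac1{|\tilde{\mathcal D}|}\sum_{z\in\tilde{\mathcal D}}\|\nabla\ell(z;\theta)\|^2\le B\|\nabla\mathcal L_{\tilde{\mathcal D}}(\theta)\|^2+C$;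 4. $\ell(z;\theta)\ge0$ for all $z,\theta$, and $\ell(z;\theta_0)\le\ell_{\theta_0}$ for all $z$. Let $n\ge1$, $0\le m\le n$ with $\frac mn<\frac1{6B+1}$, let $0<\eta\le\frac1{BL}$, let $b\ge1$ be a batch size, let $0<\epsilon\le1$ and $0<\delta<1$, and let $K,T\ge0$ be integers with $$T\ \ge\ K+\frac{\log(\ell_{\theta_0})-\log\left(\frac{5C}{4B\mu}\right)}{\log\left(\frac1{1-\eta\mu/2}\right)} .$$ Put $$\sigma=\frac{\Sigma}{\epsilon}\sqrt{\frac{2\log(1.25/\delta)}{\delta}},\qquad \Sigma\ge0,\quad \Sigma^2=\frac{5C}{\mu^2B}\left(\left(1-\tfrac{\eta\mu}2\right)^{2K}+2\left(1-\tfrac{\eta\mu}2\right)^{K}\right)+\frac{4L\eta C}{\mu^2}.$$ One step of SGD on a dataset $\tilde{\mathcal D}$ draws a mini-batch of $b$ samples independently and uniformly with replacement from $\tilde{\mathcal D}$ and replaces $\theta$ by $\theta-\eta g$, where $g$ is the average of $\nabla\ell(z;\theta)$ over the mini-batch; mini-batches of different steps are independent. The SGD-D2D learning algorithm on $\tilde{\mathcal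 D}$ makes $T$ such steps from $\theta_0$, saves the last iterate $\theta_T$, and outputs $\theta_T+\xi$. To unlearn a part $Z$ of the training dataset $\mathcal D$, the SGD-D2D unlearning algorithm starts from the saved $\theta_T$ (learned on $\mathcal D$), makes $K$ such steps on $\mathcal D\setminus Z$ with fresh mini-batches, giving $\theta''_K$, and outputs $\theta''_K+\xi'$. Here $\xi,\xi'\sim\mathcal N(0,\sigma^2I_d)$ are independent of the mini-batches. Then SGD-D2D is an $(\epsilon,2\delta)$-certified unlearning algorithm: for every dataset $\mathcal D$ of size $n$ and every $Z\subset\mathcal D$ of size $m$, the output $X$ of unlearning $Z$ after learning on $\mathcal D$ and the output $Y$ of learning on $\mathcal D\setminus Z$ satisfy, for every Borel set $S\subseteq\mathbb R^d$, $$\mathbb P[X\in S]\le e^{\epsilon}\,\mathbb P[Y\in S]+2\delta\quad\text{and}\quad \mathbb P[Y\in S]\le e^{\epsilon}\,\mathbb P[X\in S]+2\delta .$$ -/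

import Mathlib

open MeasureTheory ProbabilityTheory

noncomputable section

namespace D2D

/-- The parameter space `ℝ^d` with its Euclidean norm. -/
abbrev Param (d : ℕ) : Type := EuclideanSpace ℝ (Fin d)

section Loss

variable {𝒵 : Type*} {d : ℕ}

/-- `ℓ z` is differentiable and `L`-smooth in the parameter, for every sample `z`. -/
def IsSmoothLoss (ℓ : 𝒵 → Param d → ℝ) (L : ℝ) : Prop :=
  ∀ z, Differentiable ℝ (ℓ z) ∧
    ∀ θ₁ θ₂, ‖gradient (ℓ z) θ₁ - gradient (ℓ z) θ₂‖ ≤ L * ‖θ₁ - θ₂‖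

/-- `ℓ z` is `μ`-strongly convex in the parameter, for every sample `z`. -/
def IsStronglyConvexLoss (ℓ : 𝒵 → Param d → ℝ) (μ : ℝ) : Prop :=
  ∀ z θ₁ θ₂, ℓ z θ₂ + inner ℝ (gradient (ℓ z) θ₂) (θ₁ - θ₂) + μ / 2 * ‖θ₂ - θ₁‖ ^ 2 ≤ ℓ z θ₁

/-- The empirical loss of a dataset. A dataset is a finite family of samples (so a sample may
occur more than once), indexed by a finite type `ι`. -/
def empiricalLoss {ι : Type} [Fintype ι] (ℓ : 𝒵 → Param d → ℝ) (D : ι → 𝒵) (θ : Param d) : ℝ :=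
  (∑ i, ℓ (D i) θ) / Fintype.card ι

/-- The relative second-moment bound with constants `B`, `C`: on every finite non-empty dataset,
the second moment of the gradient at a uniformly drawn sample is at most
`B * ‖gradient of the empirical loss‖ ^ 2 + C`. -/
def HasRelativeSecondMoment (ℓ : 𝒵 → Param d → ℝ) (B C : ℝ) : Prop :=
  ∀ (ι : Type) [Fintype ι] [Nonempty ι] (D : ι → 𝒵) (θ : Param d),
    (∑ i, ‖gradient (ℓ (D i)) θ‖ ^ 2) / Fintype.card ι
      ≤ B * ‖gradient (empiricalLoss ℓ D) θ‖ ^ 2 + C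

/-- The loss is nonnegative, and bounded by `ℓ₀` at the initial point `θ₀`. -/
def HasBoundedInit (ℓ : 𝒵 → Param d → ℝ) (θ₀ : Param d) (ℓ₀ : ℝ) : Prop :=
  (∀ z θ, 0 ≤ ℓ z θ) ∧ ∀ z, ℓ z θ₀ ≤ ℓ₀

/-! ### Stochastic gradient descent -/

/-- The gradient estimator of a mini-batch `β`, a list of `b` indices into the dataset. -/
def batchGradient {ι : Type} {b : ℕ} (ℓ : 𝒵 → Param d → ℝ) (D : ι → 𝒵) (β : Fin b → ι)
    (θ : Param d) : Param d :=
  (b : ℝ)⁻¹ • ∑ j, gradient (ℓ (D (β j))) θ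

/-- One step of SGD: draw a mini-batch of size `b` uniformly with replacement (that is, a uniform
element of `Fin b → ι`) and move along its gradient estimator with step size `η`. -/
def sgdStep {ι : Type} [Fintype ι] [Nonempty ι] (ℓ : 𝒵 → Param d → ℝ) (η : ℝ) (b : ℕ)
    (D : ι → 𝒵) (θ : Param d) : PMF (Param d) :=
  (PMF.uniformOfFintype (Fin b → ι)).map fun β => θ - η • batchGradient ℓ D β θ

/-- The law of the iterate after `t` steps of SGD on `D`, started at `θ`, with independent
mini-batches. -/
def sgd {ι : Type} [Fintype ι] [Nonempty ι] (ℓ : 𝒵 → Param d → ℝ) (η : ℝ) (b : ℕ)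
    (D : ι → 𝒵) (θ : Param d) : ℕ → PMF (Param d)
  | 0 => PMF.pure θ
  | t + 1 => (sgd ℓ η b D θ t).bind (sgdStep ℓ η b D)

end Loss

/-! ### Indistinguishability and certified unlearning -/

/-- Two output laws are `(ε, δ)`-indistinguishable. -/
def Indistinguishable {Θ : Type*} [MeasurableSpace Θ] (ε δ : ℝ) (P Q : Measure Θ) : Prop :=
  ∀ S, MeasurableSet S →
    P S ≤ ENNReal.ofReal (Real.exp ε) * Q S + ENNReal.ofReal δ ∧
    Q S ≤ ENNReal.ofReal (Real.exp ε) * P S + ENNReal.ofReal δ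

/-- The retained dataset `D \ Z`, where the unlearned set is given by its set `Z` of indices. -/
def retained {𝒵 : Type*} {ι : Type} (D : ι → 𝒵) (Z : Finset ι) : {i // i ∉ Z} → 𝒵 :=
  fun i => D i

/-- Certified unlearning on the dataset `D`, for unlearned sets of size `m`.
`A` sends a finite non-empty dataset to the law of the model that the learning algorithm outputs
on it, and `UA Z` is the law of the model that the unlearning algorithm outputs when it is asked
to unlearn `Z` after the learning algorithm was run on `D`. -/
def IsCertifiedUnlearning {𝒵 Θ : Type*} [MeasurableSpace Θ] {ι : Type} [Fintype ι] [DecidableEq ι]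
    (ε δ : ℝ) (m : ℕ) (D : ι → 𝒵)
    (A : ∀ (κ : Type) [Fintype κ] [Nonempty κ], (κ → 𝒵) → Measure Θ)
    (UA : ∀ (Z : Finset ι) [Nonempty {i // i ∉ Z}], Measure Θ) : Prop :=
  ∀ (Z : Finset ι) [Nonempty {i // i ∉ Z}], Z.card = m →
    Indistinguishable ε δ (UA Z) (A {i // i ∉ Z} (retained D Z))

section Algorithm

variable {𝒵 : Type*} {d : ℕ}

/-- The law of `x + ξ`, where `x` has law `p` and `ξ` is independent Gaussian noise with law
`N(0, σ² I)`. -/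
def addGaussianNoise (σ : ℝ) (p : PMF (Param d)) : Measure (Param d) :=
  p.toMeasure.conv ((stdGaussian (Param d)).map fun x => σ • x)

/-- SGD-D2D learning: `T` steps of SGD on the dataset from `θ₀`, then Gaussian noise. -/
def learn (ℓ : 𝒵 → Param d → ℝ) (η : ℝ) (b : ℕ) (θ₀ : Param d) (T : ℕ) (σ : ℝ)
    (κ : Type) [Fintype κ] [Nonempty κ] (D : κ → 𝒵) : Measure (Param d) :=
  addGaussianNoise σ (sgd ℓ η b D θ₀ T)

/-- SGD-D2D learning on `D` followed by SGD-D2D unlearning of `Z`: the unlearning algorithm starts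
at the checkpoint `θ_T`, the last (noiseless) learning iterate on `D`, takes `K` steps of SGD on
the retained dataset with fresh mini-batches, and adds Gaussian noise. -/
def learnThenUnlearn {ι : Type} [Fintype ι] [DecidableEq ι] [Nonempty ι]
    (ℓ : 𝒵 → Param d → ℝ) (η : ℝ) (b : ℕ) (θ₀ : Param d) (T K : ℕ) (σ : ℝ) (D : ι → 𝒵)
    (Z : Finset ι) [Nonempty {i // i ∉ Z}] : Measure (Param d) :=
  addGaussianNoise σ
    ((sgd ℓ η b D θ₀ T).bind fun θT => sgd ℓ η b (retained D Z) θT K)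

end Algorithm

end D2D

end

/-! Both noiseless outputs are close in mean square to the minimizer `c'` of the retained loss. If x
and y are independent copies of them, then E‖x - y‖² ≤ 2(E‖x - c'‖² + E‖y - c'‖²) ≤ Σ². Pairs with
‖x - y‖² ≤ Σ²/δ are covered by the Gaussian mechanism, which costs δ; by Markov the remaining pairs
have probability at most δ. This gives 2δ and explains the extra 1/δ under the root in σ
(`addGaussianNoise_le`).

For the distances, one SGD step maps the mean squared distance r to the minimizer to at most (1 -
ημ)r + η²C (`sum_norm_sgd_update_sub_sq_le`), so the initial error decays geometrically to a floor
ηC/μ, and T is large enough for the learned error to carry a factor (1 - ημ/2)^K. Learning on the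
full data targets another minimizer `c`. At `c'` the full gradient comes only from the small set Z,
so the moment bound and strong convexity give ‖c - c'‖² ≤ C/(5Bμ²)
(`norm_gradient_sq_le_of_retained`). The K unlearning steps contract this gap, and
`exists_meanSqDist_add_le` adds everything up to Σ². -/

/-! ### The Gaussian mechanism in a Euclidean space. -/

section GaussianMechanism

open scoped ENNReal

variable {E : Type*} [NormedAddCommGroup E] [InnerProductSpace ℝ E] [FiniteDimensional ℝ E]
  [MeasurableSpace E] [BorelSpace E]

/-- The density of the standard Gaussian distribution with respect to the volume. -/
noncomputable def stdGaussianDensity (v : E) : ℝ :=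
  (∫ w : E, Real.exp (-(1 / 2) * ‖w‖ ^ 2))⁻¹ * Real.exp (-(1 / 2) * ‖v‖ ^ 2)

lemma integral_exp_neg_half_norm_sq_pos :
    0 < ∫ w : E, Real.exp (-(1 / 2) * ‖w‖ ^ 2) := by
  rw [GaussianFourier.integral_rexp_neg_mul_sq_norm (by norm_num)]
  positivity

lemma stdGaussianDensity_pos (v : E) : 0 < stdGaussianDensity v :=
  mul_pos (inv_pos.2 integral_exp_neg_half_norm_sq_pos) (Real.exp_pos _)

lemma measurable_stdGaussianDensity : Measurable (stdGaussianDensity (E := E)) := by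
  unfold stdGaussianDensity
  fun_prop

lemma integral_stdGaussianDensity : ∫ v : E, stdGaussianDensity v = 1 := by
  unfold stdGaussianDensity
  rw [integral_const_mul, inv_mul_cancel₀ integral_exp_neg_half_norm_sq_pos.ne']

lemma lintegral_stdGaussianDensity :
    ∫⁻ v : E, ENNReal.ofReal (stdGaussianDensity v) = 1 := by
  rw [← ofReal_integral_eq_lintegral_ofReal, integral_stdGaussianDensity, ENNReal.ofReal_one]
  -- A non-integrable function has integral 0 by convention, so the value 1 forces integrability.
  · by_contra h
    have := integral_stdGaussianDensity (E := E)
    rw [integral_undef h] at this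
    exact zero_ne_one this
  · exact Filter.Eventually.of_forall fun v => (stdGaussianDensity_pos v).le

/-- Both sides have the same characteristic function, by the Fourier transform of a Gaussian. -/
lemma stdGaussian_eq_withDensity :
    stdGaussian E = volume.withDensity fun v => ENNReal.ofReal (stdGaussianDensity v) := by
  have hfin : IsFiniteMeasure
      ((volume : Measure E).withDensity fun v => ENNReal.ofReal (stdGaussianDensity v)) := by
    refine isFiniteMeasure_withDensity ?_
    rw [lintegral_stdGaussianDensity]
    exact ENNReal.one_ne_top
  refine Measure.ext_of_charFun (funext fun t => ?_)
  rw [charFun_stdGaussian, charFun_apply, integral_withDensity_eq_integral_toReal_smul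
    measurable_stdGaussianDensity.ennreal_ofReal
    (Filter.Eventually.of_forall fun v => ENNReal.ofReal_lt_top)]
  have h1 : ∀ v : E, (ENNReal.ofReal (stdGaussianDensity v)).toReal •
      Complex.exp ((inner ℝ v t : ℝ) * Complex.I) =
      ((∫ w : E, Real.exp (-(1 / 2) * ‖w‖ ^ 2) : ℝ) : ℂ)⁻¹ *
        Complex.exp (-(1 / 2 : ℂ) * ‖v‖ ^ 2 + Complex.I * (inner ℝ t v : ℝ)) := by
    intro v
    rw [ENNReal.toReal_ofReal (stdGaussianDensity_pos v).le, stdGaussianDensity,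
      Complex.real_smul, Complex.exp_add, real_inner_comm]
    push_cast
    ring_nf
  have h2 : ((∫ w : E, Real.exp (-(1 / 2) * ‖w‖ ^ 2) : ℝ) : ℂ) =
      ∫ w : E, Complex.exp (-(1 / 2 : ℂ) * ‖w‖ ^ 2) := by
    rw [← integral_complex_ofReal]
    congr 1
    ext v
    push_cast
    rfl
  have h3 := integral_exp_neg_half_norm_sq_pos (E := E)
  simp_rw [h1]
  rw [integral_const_mul, GaussianFourier.integral_cexp_neg_mul_sq_norm_add (by norm_num),
    ← GaussianFourier.integral_cexp_neg_mul_sq_norm (by norm_num), ← h2, ← mul_assoc,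
    inv_mul_cancel₀ (by exact_mod_cast h3.ne'), one_mul, Complex.I_sq]
  ring_nf

lemma stdGaussian_apply (A : Set E) (hA : MeasurableSet A) :
    stdGaussian E A = ∫⁻ v in A, ENNReal.ofReal (stdGaussianDensity v) := by
  rw [stdGaussian_eq_withDensity, withDensity_apply _ hA]

/-- The law of a shifted standard Gaussian has the shifted density. -/
lemma stdGaussian_preimage_sub (A : Set E) (hA : MeasurableSet A) (h : E) :
    stdGaussian E ((fun v => v - h) ⁻¹' A) =
      ∫⁻ v in A, ENNReal.ofReal (stdGaussianDensity (v + h)) := by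
  have hm : Measurable fun v : E => ENNReal.ofReal (stdGaussianDensity (v + h)) :=
    (measurable_stdGaussianDensity.comp (measurable_add_const h)).ennreal_ofReal
  rw [stdGaussian_apply _ (hA.preimage (measurable_sub_const h)),
    ← (measurePreserving_sub_right volume h).setLIntegral_comp_preimage hA hm]
  simp

/-- Weighted AM-GM: with weights 1/(1+s) and s/(1+s) the geometric mean of exp(sx) and exp(-x) is 1.
-/
lemma one_add_le_exp_mul_add_mul_exp_neg {s : ℝ} (hs : 0 ≤ s) (x : ℝ) :
    1 + s ≤ Real.exp (s * x) + (1 + s) * Real.exp (-x) := by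
  have h1 : (1 + s) * Real.exp (-x) ≥ 0 := by positivity
  rcases le_or_gt x 0 with hx | hx
  · have : 1 ≤ Real.exp (-x) := Real.one_le_exp (by linarith)
    have := Real.exp_pos (s * x)
    nlinarith
  · have hp : 0 < 1 + s := by linarith
    have h := Real.geom_mean_le_arith_mean2_weighted (w₁ := 1 / (1 + s)) (w₂ := s / (1 + s))
      (p₁ := Real.exp (s * x)) (p₂ := Real.exp (-x)) (by positivity) (by positivity)
      (Real.exp_pos _).le (Real.exp_pos _).le (by field_simp)
    rw [← Real.exp_mul, ← Real.exp_mul, ← Real.exp_add,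
      show s * x * (1 / (1 + s)) + -x * (s / (1 + s)) = 0 by ring, Real.exp_zero] at h
    have h2 : (1 + s) * (1 / (1 + s) * Real.exp (s * x) + s / (1 + s) * Real.exp (-x))
        = Real.exp (s * x) + s * Real.exp (-x) := by field_simp
    have := Real.exp_pos (-x)
    nlinarith

/-- A pointwise Chernoff bound: the previous inequality is applied to x, the log-ratio of the two
densities minus ε. Tilting the density at v + h by exp(sx) gives a multiple of another shifted
Gaussian, so the error term has an explicit integral. -/
lemma stdGaussianDensity_add_le {s : ℝ} (hs : 0 ≤ s) (ε : ℝ) (v h : E) :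
    stdGaussianDensity (v + h) ≤ Real.exp ε * stdGaussianDensity v +
      Real.exp (s * (1 + s) * ‖h‖ ^ 2 / 2 - s * ε) / (1 + s) *
        stdGaussianDensity (v + (1 + s) • h) := by
  have hZ := inv_pos.2 (integral_exp_neg_half_norm_sq_pos (E := E))
  unfold stdGaussianDensity
  set Z := (∫ w : E, Real.exp (-(1 / 2) * ‖w‖ ^ 2))⁻¹
  set a := inner ℝ v h
  have e1 : ‖v + h‖ ^ 2 = ‖v‖ ^ 2 + 2 * a + ‖h‖ ^ 2 := norm_add_sq_real v h
  have e2 : ‖v + (1 + s) • h‖ ^ 2 = ‖v‖ ^ 2 + 2 * (1 + s) * a + (1 + s) ^ 2 * ‖h‖ ^ 2 := by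
    rw [norm_add_sq_real, real_inner_smul_right, norm_smul, mul_pow, Real.norm_eq_abs, sq_abs]
    ring
  have key := one_add_le_exp_mul_add_mul_exp_neg hs (-a - ‖h‖ ^ 2 / 2 - ε)
  have hp : 0 < 1 + s := by linarith
  set P := Real.exp (-(1 / 2) * ‖v + h‖ ^ 2) with hP
  have f1 : Real.exp ε * Real.exp (-(1 / 2) * ‖v‖ ^ 2) =
      P * Real.exp (-(-a - ‖h‖ ^ 2 / 2 - ε)) := by
    rw [hP, ← Real.exp_add, ← Real.exp_add, e1]
    ring_nf
  have f2 : Real.exp (s * (1 + s) * ‖h‖ ^ 2 / 2 - s * ε) *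
      Real.exp (-(1 / 2) * ‖v + (1 + s) • h‖ ^ 2) =
      P * Real.exp (s * (-a - ‖h‖ ^ 2 / 2 - ε)) := by
    rw [hP, ← Real.exp_add, ← Real.exp_add, e1, e2]
    ring_nf
  have hPZ : 0 < Z * P := mul_pos hZ (Real.exp_pos _)
  calc Z * P = Z * P * (1 + s) / (1 + s) := by field_simp
    _ ≤ Z * P * (Real.exp (s * (-a - ‖h‖ ^ 2 / 2 - ε)) +
          (1 + s) * Real.exp (-(-a - ‖h‖ ^ 2 / 2 - ε))) / (1 + s) := by gcongr
    _ = Z * (P * Real.exp (-(-a - ‖h‖ ^ 2 / 2 - ε))) +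
          Z * (P * Real.exp (s * (-a - ‖h‖ ^ 2 / 2 - ε))) / (1 + s) := by
        field_simp
        ring
    _ = _ := by
        rw [← f1, ← f2]
        ring

/-- The Gaussian mechanism: shifting a standard Gaussian by a vector of norm at most
`ε / √(2 log (1.25 / δ))` is `(ε, δ)`-indistinguishable. -/
lemma stdGaussian_preimage_sub_le {ε δ : ℝ} (hε : 0 < ε) (hε1 : ε ≤ 1) (hδ : 0 < δ)
    (hδ1 : δ < 1) (h : E) (hh : 2 * Real.log (1.25 / δ) * ‖h‖ ^ 2 ≤ ε ^ 2)
    (A : Set E) (hA : MeasurableSet A) :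
    stdGaussian E ((fun v => v - h) ⁻¹' A) ≤
      ENNReal.ofReal (Real.exp ε) * stdGaussian E A + ENNReal.ofReal δ := by
  set l := Real.log (1.25 / δ) with hl
  have hl2 : 0.2 ≤ l := by
    have h1 : Real.log 1.25 ≤ l := Real.log_le_log (by norm_num) (by
      rw [le_div_iff₀ hδ]; nlinarith)
    have h2 := Real.one_sub_inv_le_log_of_pos (show (0 : ℝ) < 1.25 by norm_num)
    norm_num at h1 h2 ⊢
    linarith
  -- At the extreme ‖h‖² = ε²/(2l) the exponent is minimized at 2l/ε - 1/2; dropping the 1/2 leaves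
  -- the simple bound ε/2 - l.
  set s := 2 * l / ε with hs
  have hsε : s * ε = 2 * l := by rw [hs]; field_simp
  have hs1 : 0.4 ≤ s := by
    rw [hs, le_div_iff₀ hε]
    nlinarith
  have hs0 : 0 ≤ s := by linarith
  set κ := Real.exp (s * (1 + s) * ‖h‖ ^ 2 / 2 - s * ε) / (1 + s) with hκ
  have hκ0 : 0 ≤ κ := by positivity
  have hκδ : κ ≤ δ := by
    have h1 : s * (1 + s) * ‖h‖ ^ 2 / 2 - s * ε ≤ ε / 2 - l := by
      have h2 : s * ‖h‖ ^ 2 ≤ ε := by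
        rw [hs, div_mul_eq_mul_div, div_le_iff₀ hε]
        nlinarith
      have h3 : s * (1 + s) * ‖h‖ ^ 2 ≤ (1 + s) * ε := by
        have := mul_le_mul_of_nonneg_left h2 (by linarith : 0 ≤ 1 + s)
        linarith
      have h4 : (1 + s) * ε = ε + 2 * l := by rw [add_mul, hsε, one_mul]
      linarith
    -- 1.75 bounds √e, and 1.75/1.25 = 1.4 ≤ 1 + s, which is why the constant 1.25 suffices.
    have hexp : Real.exp (ε / 2) ≤ 1.75 := by
      have h1 : Real.exp (ε / 2) ≤ Real.exp (1 / 2) := Real.exp_le_exp.2 (by linarith)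
      have h2 : Real.exp (1 / 2) ^ 2 = Real.exp 1 := by
        rw [← Real.exp_nat_mul]; norm_num
      have h3 := Real.exp_one_lt_d9
      have h4 := Real.exp_pos (1 / 2)
      nlinarith
    have hexpl : Real.exp (-l) = δ / 1.25 := by
      rw [Real.exp_neg, hl, Real.exp_log (by positivity), inv_div]
    rw [hκ, div_le_iff₀ (by linarith)]
    calc _ ≤ Real.exp (ε / 2 - l) := Real.exp_le_exp.2 h1
      _ = Real.exp (ε / 2) * (δ / 1.25) := by rw [sub_eq_add_neg, Real.exp_add, hexpl]
      _ ≤ 1.75 * (δ / 1.25) := by gcongr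
      _ = δ * 1.4 := by ring
      _ ≤ δ * (1 + s) := by gcongr; linarith
  have hm := measurable_stdGaussianDensity (E := E)
  rw [stdGaussian_preimage_sub A hA]
  calc ∫⁻ v in A, ENNReal.ofReal (stdGaussianDensity (v + h))
      ≤ ∫⁻ v in A, (ENNReal.ofReal (Real.exp ε) * ENNReal.ofReal (stdGaussianDensity v) +
        ENNReal.ofReal κ * ENNReal.ofReal (stdGaussianDensity (v + (1 + s) • h))) := by
        refine lintegral_mono fun v => ?_
        have := (stdGaussianDensity_pos v).le
        have := (stdGaussianDensity_pos (v + (1 + s) • h)).le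
        rw [← ENNReal.ofReal_mul (Real.exp_pos _).le, ← ENNReal.ofReal_mul hκ0,
          ← ENNReal.ofReal_add (by positivity) (by positivity)]
        exact ENNReal.ofReal_le_ofReal (stdGaussianDensity_add_le hs0 ε v h)
    _ = ENNReal.ofReal (Real.exp ε) * stdGaussian E A + ENNReal.ofReal κ *
        ∫⁻ v in A, ENNReal.ofReal (stdGaussianDensity (v + (1 + s) • h)) := by
        rw [lintegral_add_left (hm.ennreal_ofReal.const_mul _), lintegral_const_mul _
          hm.ennreal_ofReal, lintegral_const_mul' _ _ ENNReal.ofReal_ne_top,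
          stdGaussian_apply _ hA]
    _ ≤ ENNReal.ofReal (Real.exp ε) * stdGaussian E A + ENNReal.ofReal δ * 1 := by
        gcongr
        calc _ ≤ ∫⁻ v, ENNReal.ofReal (stdGaussianDensity (v + (1 + s) • h)) :=
              setLIntegral_le_lintegral _ _
          _ = ∫⁻ v : E, ENNReal.ofReal (stdGaussianDensity v) :=
              lintegral_add_right_eq_self (fun v => ENNReal.ofReal (stdGaussianDensity v)) _
          _ = 1 := lintegral_stdGaussianDensity
    _ = _ := by rw [mul_one]

end GaussianMechanism

namespace D2D

/-! ### Noise added to random points that are close in mean square. -/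

section NoisyMixtures

open scoped ENNReal

variable {d : ℕ}

lemma addGaussianNoise_apply (σ : ℝ) (p : PMF (Param d)) (S : Set (Param d))
    (hS : MeasurableSet S) :
    addGaussianNoise σ p S = ∑' x, p x * stdGaussian (Param d) {v | x + σ • v ∈ S} := by
  have hp : p.toMeasure = Measure.sum fun x => p x • Measure.dirac x := by
    ext s hs
    rw [PMF.toMeasure_apply _ hs, Measure.sum_apply _ hs]
    refine tsum_congr fun x => ?_
    by_cases hx : x ∈ s <;> simp [hx, hs]
  have hprob : IsProbabilityMeasure ((stdGaussian (Param d)).map fun x => σ • x) :=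
    Measure.isProbabilityMeasure_map (by fun_prop)
  have hmeas : Measurable fun z : Param d × Param d => z.1 + z.2 := by fun_prop
  rw [addGaussianNoise, Measure.conv, Measure.map_apply hmeas hS,
    Measure.prod_apply (hmeas hS), hp, lintegral_sum_measure]
  refine tsum_congr fun x => ?_
  rw [lintegral_smul_measure, lintegral_dirac, smul_eq_mul,
    Measure.map_apply (by fun_prop) (measurable_prodMk_left (hmeas hS))]
  rfl

/-- The mean squared distance to `c` of a random point with law `p`. -/
noncomputable def meanSqDist (p : PMF (Param d)) (c : Param d) : ℝ≥0∞ :=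
  ∑' x, p x * ENNReal.ofReal (‖x - c‖ ^ 2)

/-- Markov's inequality in pointwise form: either ‖x - y‖² ≤ Δ²/δ and the Gaussian mechanism
applies, or the last term already exceeds 1. -/
lemma stdGaussian_affine_preimage_le {ε δ Δ σ : ℝ} (hε : 0 < ε) (hε1 : ε ≤ 1)
    (hδ : 0 < δ) (hδ1 : δ < 1) (hΔ : 0 < Δ)
    (hσ : σ = Δ / ε * Real.sqrt (2 * Real.log (1.25 / δ) / δ))
    {S : Set (Param d)} (hS : MeasurableSet S) (x y : Param d) :
    stdGaussian (Param d) {v | x + σ • v ∈ S} ≤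
      ENNReal.ofReal (Real.exp ε) * stdGaussian (Param d) {v | y + σ • v ∈ S} +
        ENNReal.ofReal δ + ENNReal.ofReal (δ / Δ ^ 2) * ENNReal.ofReal (‖x - y‖ ^ 2) := by
  have hl : 0 < Real.log (1.25 / δ) := Real.log_pos (by rw [lt_div_iff₀ hδ]; linarith)
  have hσ0 : 0 < σ := by rw [hσ]; positivity
  have hσ2 : σ ^ 2 = Δ ^ 2 / ε ^ 2 * (2 * Real.log (1.25 / δ) / δ) := by
    rw [hσ, mul_pow, Real.sq_sqrt (by positivity), div_pow]
  rcases le_or_gt (δ / Δ ^ 2 * ‖x - y‖ ^ 2) 1 with hxy | hxy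
  · have hh : 2 * Real.log (1.25 / δ) * ‖σ⁻¹ • (y - x)‖ ^ 2 ≤ ε ^ 2 := by
      rw [norm_smul, mul_pow, norm_sub_rev, norm_inv, inv_pow, Real.norm_eq_abs, sq_abs, hσ2]
      calc _ = ε ^ 2 * (δ / Δ ^ 2 * ‖x - y‖ ^ 2) := by field_simp
        _ ≤ ε ^ 2 * 1 := by gcongr
        _ = ε ^ 2 := mul_one _
    have hA : MeasurableSet {v | y + σ • v ∈ S} :=
      hS.preimage (f := fun v => y + σ • v) (by fun_prop)
    have h := stdGaussian_preimage_sub_le hε hε1 hδ hδ1 (σ⁻¹ • (y - x)) hh _ hA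
    have hset : (fun v => v - σ⁻¹ • (y - x)) ⁻¹' {v | y + σ • v ∈ S} = {v | x + σ • v ∈ S} := by
      ext v
      simp only [Set.mem_preimage, Set.mem_ofPred_eq, smul_sub, smul_inv_smul₀ hσ0.ne']
      rw [show y + (σ • v - (y - x)) = x + σ • v by abel]
    rw [hset] at h
    exact h.trans le_self_add
  · calc _ ≤ (1 : ℝ≥0∞) := prob_le_one
      _ ≤ ENNReal.ofReal (δ / Δ ^ 2) * ENNReal.ofReal (‖x - y‖ ^ 2) := by
        rw [← ENNReal.ofReal_mul (by positivity), ← ENNReal.ofReal_one]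
        exact ENNReal.ofReal_le_ofReal hxy.le
      _ ≤ _ := le_add_self

/-- The pointwise bound is averaged over y, then over x, that is, over the product coupling; the
squared-distance terms average to at most δ. -/
lemma addGaussianNoise_le {ε δ Δ σ : ℝ} (hε : 0 < ε) (hε1 : ε ≤ 1)
    (hδ : 0 < δ) (hδ1 : δ < 1) (hΔ : 0 < Δ)
    (hσ : σ = Δ / ε * Real.sqrt (2 * Real.log (1.25 / δ) / δ))
    {S : Set (Param d)} (hS : MeasurableSet S) (p q : PMF (Param d)) (c : Param d)
    (hpq : 2 * (meanSqDist p c + meanSqDist q c) ≤ ENNReal.ofReal (Δ ^ 2)) :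
    addGaussianNoise σ p S ≤
      ENNReal.ofReal (Real.exp ε) * addGaussianNoise σ q S + ENNReal.ofReal (2 * δ) := by
  rw [addGaussianNoise_apply σ p S hS, addGaussianNoise_apply σ q S hS]
  set G : Param d → ℝ≥0∞ := fun x => stdGaussian (Param d) {v | x + σ • v ∈ S}
  set e := ENNReal.ofReal (Real.exp ε)
  set k := ENNReal.ofReal (δ / Δ ^ 2)
  set D := ENNReal.ofReal δ
  have hpt : ∀ x y, G x ≤ e * G y + D + k * (2 * ENNReal.ofReal (‖x - c‖ ^ 2)) +
      k * (2 * ENNReal.ofReal (‖y - c‖ ^ 2)) := by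
    intro x y
    refine (stdGaussian_affine_preimage_le hε hε1 hδ hδ1 hΔ hσ hS x y).trans ?_
    rw [add_assoc _ (k * _), ← mul_add]
    gcongr
    rw [← mul_add, ← ENNReal.ofReal_add (by positivity) (by positivity), two_mul,
      ← ENNReal.ofReal_add (by positivity) (by positivity)]
    refine ENNReal.ofReal_le_ofReal ?_
    have h1 : ‖x - y‖ ≤ ‖x - c‖ + ‖y - c‖ := by
      rw [← norm_sub_rev c y]; exact norm_sub_le_norm_sub_add_norm_sub x c y
    have := norm_nonneg (x - y)
    nlinarith [sq_nonneg (‖x - c‖ - ‖y - c‖)]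
  have hq : ∀ x, G x ≤ e * (∑' y, q y * G y) + D + k * (2 * ENNReal.ofReal (‖x - c‖ ^ 2)) +
      k * (2 * meanSqDist q c) := by
    intro x
    calc G x = ∑' y, q y * G x := by rw [ENNReal.tsum_mul_right, q.tsum_coe, one_mul]
      _ ≤ ∑' y, (e * (q y * G y) + q y * (D + k * (2 * ENNReal.ofReal (‖x - c‖ ^ 2))) +
            k * (2 * (q y * ENNReal.ofReal (‖y - c‖ ^ 2)))) := by
          refine ENNReal.tsum_le_tsum fun y => ?_
          calc _ ≤ q y * _ := mul_le_mul_right (hpt x y) _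
            _ = _ := by ring
      _ = _ := by
          rw [ENNReal.tsum_add, ENNReal.tsum_add, ENNReal.tsum_mul_left, ENNReal.tsum_mul_right,
            q.tsum_coe, ENNReal.tsum_mul_left, ENNReal.tsum_mul_left, one_mul, meanSqDist]
          ring
  have hk : k * (2 * (meanSqDist p c + meanSqDist q c)) ≤ D := by
    calc _ ≤ k * ENNReal.ofReal (Δ ^ 2) := by gcongr
      _ = D := by
        rw [← ENNReal.ofReal_mul (by positivity), div_mul_cancel₀ _ (by positivity)]
  calc ∑' x, p x * G x
      ≤ ∑' x, (p x * (e * (∑' y, q y * G y) + D + k * (2 * meanSqDist q c)) +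
          k * (2 * (p x * ENNReal.ofReal (‖x - c‖ ^ 2)))) := by
        refine ENNReal.tsum_le_tsum fun x => ?_
        calc _ ≤ p x * _ := mul_le_mul_right (hq x) _
          _ = _ := by ring
    _ = e * (∑' y, q y * G y) + D + k * (2 * (meanSqDist p c + meanSqDist q c)) := by
        rw [ENNReal.tsum_add, ENNReal.tsum_mul_right, p.tsum_coe, ENNReal.tsum_mul_left,
          ENNReal.tsum_mul_left, one_mul]
        simp only [meanSqDist]
        ring
    _ ≤ e * (∑' y, q y * G y) + D + D := by gcongr
    _ = _ := by
        rw [add_assoc, ← ENNReal.ofReal_add hδ.le hδ.le, two_mul]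

/-- Gaussian noise calibrated to a bound on the mean squared distance of two random points makes
them `(ε, 2δ)`-indistinguishable. -/
lemma indistinguishable_addGaussianNoise {ε δ Δ σ : ℝ} (hε : 0 < ε) (hε1 : ε ≤ 1)
    (hδ : 0 < δ) (hδ1 : δ < 1) (hΔ : 0 < Δ)
    (hσ : σ = Δ / ε * Real.sqrt (2 * Real.log (1.25 / δ) / δ))
    (p q : PMF (Param d)) (c : Param d)
    (hpq : 2 * (meanSqDist p c + meanSqDist q c) ≤ ENNReal.ofReal (Δ ^ 2)) :
    Indistinguishable ε (2 * δ) (addGaussianNoise σ p) (addGaussianNoise σ q) := fun _ hS =>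
  ⟨addGaussianNoise_le hε hε1 hδ hδ1 hΔ hσ hS p q c hpq,
    addGaussianNoise_le hε hε1 hδ hδ1 hΔ hσ hS q p c (by rwa [add_comm (meanSqDist q c)])⟩

end NoisyMixtures

/-! ### Smooth and strongly convex functions. -/

section SmoothStronglyConvex

variable {E : Type*} [NormedAddCommGroup E] [InnerProductSpace ℝ E] [CompleteSpace E]
  {f : E → ℝ} {L μ : ℝ}

/-- The quadratic upper bound of a function with `L`-Lipschitz gradient. -/
lemma le_quadratic_of_lipschitz_gradient (hf : Differentiable ℝ f)
    (hL : ∀ x y, ‖gradient f x - gradient f y‖ ≤ L * ‖x - y‖) (x v : E) :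
    f (x + v) ≤ f x + inner ℝ (gradient f x) v + L / 2 * ‖v‖ ^ 2 := by
  have hd : ∀ t : ℝ, HasDerivAt
      (fun t : ℝ => f (x + t • v) - t * inner ℝ (gradient f x) v - L / 2 * ‖v‖ ^ 2 * t ^ 2)
      (inner ℝ (gradient f (x + t • v)) v - inner ℝ (gradient f x) v - L * ‖v‖ ^ 2 * t) t := by
    intro t
    have h1 : HasDerivAt (fun t : ℝ => x + t • v) v t := by
      simpa using ((hasDerivAt_id t).smul_const v).const_add x
    have h2 := (hf (x + t • v)).hasGradientAt.hasFDerivAt.comp_hasDerivAt t h1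
    have h3 := (h2.sub ((hasDerivAt_id t).mul_const (inner ℝ (gradient f x) v))).sub
      ((hasDerivAt_pow 2 t).const_mul (L / 2 * ‖v‖ ^ 2))
    refine h3.congr_deriv ?_
    simp
    ring
  -- Along the segment, f minus its quadratic majorant has nonpositive derivative.
  have hanti := antitoneOn_of_deriv_nonpos (convex_Icc (0 : ℝ) 1)
    (fun t _ => (hd t).continuousAt.continuousWithinAt)
    (fun t _ => (hd t).differentiableAt.differentiableWithinAt) (fun t ht => by
      rw [interior_Icc] at ht
      rw [(hd t).deriv, ← inner_sub_left]
      have h1 := real_inner_le_norm (gradient f (x + t • v) - gradient f x) v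
      have h2 := hL (x + t • v) x
      rw [add_sub_cancel_left, norm_smul, Real.norm_eq_abs, abs_of_pos ht.1] at h2
      have h3 := mul_le_mul_of_nonneg_right h2 (norm_nonneg v)
      nlinarith)
  have h := hanti (Set.left_mem_Icc.2 zero_le_one) (Set.right_mem_Icc.2 zero_le_one) zero_le_one
  simp only [one_smul, zero_smul, add_zero] at h
  linarith

/-- The gradient of a smooth function is controlled by its optimality gap. -/
lemma norm_gradient_sq_le (hL0 : 0 < L) (hf : Differentiable ℝ f)
    (hL : ∀ x y, ‖gradient f x - gradient f y‖ ≤ L * ‖x - y‖) {c : E} (hc : ∀ x, f c ≤ f x)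
    (x : E) : ‖gradient f x‖ ^ 2 ≤ 2 * L * (f x - f c) := by
  -- This step minimizes the quadratic upper bound.
  have h1 := le_quadratic_of_lipschitz_gradient hf hL x (-(L⁻¹ • gradient f x))
  rw [inner_neg_right, real_inner_smul_right, real_inner_self_eq_norm_sq, norm_neg, norm_smul,
    mul_pow, Real.norm_eq_abs, sq_abs] at h1
  have h2 := hc (x + -(L⁻¹ • gradient f x))
  have h3 : L⁻¹ * ‖gradient f x‖ ^ 2 / 2 ≤ f x - f c := by
    have : L / 2 * (L⁻¹ ^ 2 * ‖gradient f x‖ ^ 2) = L⁻¹ * ‖gradient f x‖ ^ 2 / 2 := by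
      field_simp
    linarith
  calc ‖gradient f x‖ ^ 2 = 2 * L * (L⁻¹ * ‖gradient f x‖ ^ 2 / 2) := by field_simp
    _ ≤ _ := by gcongr

lemma gradient_eq_zero_of_forall_le {c : E} (hc : ∀ x, f c ≤ f x) : gradient f c = 0 := by
  have h : IsLocalMin f c := Filter.Eventually.of_forall hc
  rw [gradient, h.fderiv_eq_zero, map_zero]

/-- Add the strong convexity inequalities at (x, y) and (y, x), then apply Cauchy-Schwarz. -/
lemma mul_norm_sub_le_norm_gradient_sub
    (hμ : ∀ x y, f y + inner ℝ (gradient f y) (x - y) + μ / 2 * ‖y - x‖ ^ 2 ≤ f x) (x y : E) :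
    μ * ‖x - y‖ ≤ ‖gradient f x - gradient f y‖ := by
  have h1 := hμ x y
  have h2 := hμ y x
  rw [← neg_sub x y, inner_neg_right] at h2
  rw [norm_sub_rev] at h1
  have h3 := real_inner_le_norm (gradient f x - gradient f y) (x - y)
  rw [inner_sub_left] at h3
  rcases eq_or_lt_of_le (norm_nonneg (x - y)) with h | h
  · rw [← h, mul_zero]
    exact norm_nonneg _
  · refine le_of_mul_le_mul_right ?_ h
    nlinarith

/-- Strong convexity at 0 makes f grow at least quadratically, hence coercive. -/
lemma exists_forall_le_of_strongly_convex [FiniteDimensional ℝ E] (hμ0 : 0 < μ)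
    (hf : Differentiable ℝ f)
    (hμ : ∀ x y, f y + inner ℝ (gradient f y) (x - y) + μ / 2 * ‖y - x‖ ^ 2 ≤ f x) :
    ∃ c, ∀ x, f c ≤ f x := by
  refine hf.continuous.exists_forall_le ?_
  have h1 : Filter.Tendsto (fun x : E => ‖x‖ * (μ / 2 * ‖x‖ - ‖gradient f 0‖) + f 0)
      (Filter.cocompact E) Filter.atTop := by
    refine Filter.tendsto_atTop_add_const_right _ _
      (Filter.Tendsto.atTop_mul_atTop₀ (tendsto_norm_cocompact_atTop) ?_)
    exact Filter.tendsto_atTop_add_const_right _ _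
      (Filter.Tendsto.const_mul_atTop (by positivity) tendsto_norm_cocompact_atTop)
  refine Filter.tendsto_atTop_mono (fun x => ?_) h1
  have h2 := hμ x 0
  rw [sub_zero, zero_sub, norm_neg] at h2
  have h3 := abs_le.1 (abs_real_inner_le_norm (gradient f 0) x)
  nlinarith [h3.1]

end SmoothStronglyConvex

/-! ### Empirical losses and the shift of the minimizer under deletion. -/

section EmpiricalLoss

variable {𝒵 : Type*} {d : ℕ} {ℓ : 𝒵 → Param d → ℝ} {ι : Type} [Fintype ι] {L μ : ℝ}

lemma hasGradientAt_empiricalLoss (hℓ : ∀ z, Differentiable ℝ (ℓ z)) (D : ι → 𝒵) (θ : Param d) :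
    HasGradientAt (empiricalLoss ℓ D)
      ((Fintype.card ι : ℝ)⁻¹ • ∑ i, gradient (ℓ (D i)) θ) θ := by
  have h : HasFDerivAt (fun θ => (Fintype.card ι : ℝ)⁻¹ • ∑ i, ℓ (D i) θ)
      ((Fintype.card ι : ℝ)⁻¹ • ∑ i, fderiv ℝ (ℓ (D i)) θ) θ :=
    (HasFDerivAt.fun_sum fun i _ => (hℓ (D i) θ).hasFDerivAt).fun_const_smul _
  have hfun : empiricalLoss ℓ D = fun θ => (Fintype.card ι : ℝ)⁻¹ • ∑ i, ℓ (D i) θ := by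
    funext θ
    rw [empiricalLoss, div_eq_inv_mul, smul_eq_mul]
  rw [hasGradientAt_iff_hasFDerivAt, map_smul, map_sum, hfun]
  simp only [toDual_gradient]
  exact h

lemma gradient_empiricalLoss (hℓ : ∀ z, Differentiable ℝ (ℓ z)) (D : ι → 𝒵) (θ : Param d) :
    gradient (empiricalLoss ℓ D) θ =
      (Fintype.card ι : ℝ)⁻¹ • ∑ i, gradient (ℓ (D i)) θ :=
  (hasGradientAt_empiricalLoss hℓ D θ).gradient

variable [Nonempty ι]

lemma IsSmoothLoss.empiricalLoss (h : IsSmoothLoss ℓ L) (D : ι → 𝒵) :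
    Differentiable ℝ (empiricalLoss ℓ D) ∧
      ∀ θ₁ θ₂, ‖gradient (D2D.empiricalLoss ℓ D) θ₁ - gradient (D2D.empiricalLoss ℓ D) θ₂‖ ≤
        L * ‖θ₁ - θ₂‖ := by
  have hℓ := fun z => (h z).1
  refine ⟨fun θ => (hasGradientAt_empiricalLoss hℓ D θ).differentiableAt, fun θ₁ θ₂ => ?_⟩
  have hN : (0 : ℝ) < Fintype.card ι := by exact_mod_cast Fintype.card_pos
  rw [gradient_empiricalLoss hℓ, gradient_empiricalLoss hℓ, ← smul_sub, ← Finset.sum_sub_distrib,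
    norm_smul, norm_inv, Real.norm_of_nonneg hN.le, inv_mul_le_iff₀ hN]
  refine (norm_sum_le _ _).trans ((Finset.sum_le_sum fun i _ => (h (D i)).2 θ₁ θ₂).trans ?_)
  simp

lemma IsStronglyConvexLoss.empiricalLoss (hℓ : ∀ z, Differentiable ℝ (ℓ z))
    (h : IsStronglyConvexLoss ℓ μ) (D : ι → 𝒵) (θ₁ θ₂ : Param d) :
    empiricalLoss ℓ D θ₂ + inner ℝ (gradient (D2D.empiricalLoss ℓ D) θ₂) (θ₁ - θ₂) +
      μ / 2 * ‖θ₂ - θ₁‖ ^ 2 ≤ D2D.empiricalLoss ℓ D θ₁ := by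
  have hN : (0 : ℝ) < Fintype.card ι := by exact_mod_cast Fintype.card_pos
  have hsum := Finset.sum_le_sum fun i (_ : i ∈ Finset.univ) => h (D i) θ₁ θ₂
  rw [Finset.sum_add_distrib, Finset.sum_add_distrib, ← sum_inner, Finset.sum_const,
    Finset.card_univ, nsmul_eq_mul] at hsum
  rw [gradient_empiricalLoss hℓ, real_inner_smul_left, D2D.empiricalLoss, D2D.empiricalLoss,
    le_div_iff₀ hN]
  refine le_trans (le_of_eq ?_) hsum
  field_simp

/-- At the minimizer of the loss on a large retained part, the gradient of the full empirical loss
is small. -/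
lemma norm_gradient_sq_le_of_retained [DecidableEq ι] {B C : ℝ} (hB : 0 < B) (hC : 0 < C)
    (hℓ : ∀ z, Differentiable ℝ (ℓ z)) (hmoment : HasRelativeSecondMoment ℓ B C) (D : ι → 𝒵)
    (Z : Finset ι) [Nonempty {i // i ∉ Z}]
    (hZ : (Z.card : ℝ) / Fintype.card ι < 1 / (6 * B + 1)) {c : Param d}
    (hc : gradient (empiricalLoss ℓ (retained D Z)) c = 0) :
    ‖gradient (empiricalLoss ℓ D) c‖ ^ 2 ≤ C / (5 * B) := by
  have hN : (0 : ℝ) < Fintype.card ι := by exact_mod_cast Fintype.card_pos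
  have hN' : (0 : ℝ) < Fintype.card {i // i ∉ Z} := by exact_mod_cast Fintype.card_pos
  have h0 : ∑ i : {i // i ∉ Z}, gradient (ℓ (D i)) c = 0 := by
    rw [gradient_empiricalLoss hℓ] at hc
    exact (smul_eq_zero.1 hc).resolve_left (inv_ne_zero hN'.ne')
  -- The retained gradients cancel at `c`, so only the deleted samples contribute.
  have hsum : ∑ i, gradient (ℓ (D i)) c = ∑ i ∈ Z, gradient (ℓ (D i)) c := by
    rw [← Fintype.sum_subtype_add_sum_subtype (· ∈ Z) fun i => gradient (ℓ (D i)) c, h0, add_zero]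
    exact (Finset.sum_subtype Z (fun _ => Iff.rfl) fun i => gradient (ℓ (D i)) c).symm
  have hm := hmoment ι D c
  rw [div_le_iff₀ hN] at hm
  set G := gradient (empiricalLoss ℓ D) c with hG
  have hGsum : (Fintype.card ι : ℝ) • G = ∑ i ∈ Z, gradient (ℓ (D i)) c := by
    rw [hG, gradient_empiricalLoss hℓ, smul_inv_smul₀ hN.ne', hsum]
  have h1 : (Fintype.card ι * ‖G‖) ^ 2 ≤
      Z.card * ((B * ‖G‖ ^ 2 + C) * Fintype.card ι) := by
    calc (Fintype.card ι * ‖G‖) ^ 2 = ‖∑ i ∈ Z, gradient (ℓ (D i)) c‖ ^ 2 := by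
          rw [← hGsum, norm_smul, Real.norm_of_nonneg hN.le]
      _ ≤ (∑ i ∈ Z, ‖gradient (ℓ (D i)) c‖) ^ 2 := by
          gcongr
          exact norm_sum_le _ _
      _ ≤ Z.card * ∑ i ∈ Z, ‖gradient (ℓ (D i)) c‖ ^ 2 := sq_sum_le_card_mul_sum_sq
      _ ≤ Z.card * ∑ i, ‖gradient (ℓ (D i)) c‖ ^ 2 := by
          gcongr
          exact Finset.subset_univ Z
      _ ≤ _ := by gcongr
  rw [div_lt_div_iff₀ hN (by positivity), one_mul] at hZ
  have hX : 0 < B * ‖G‖ ^ 2 + C := by positivity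
  -- The bound on m/n turns `h1` into (6B+1)‖G‖² ≤ B‖G‖² + C; absorbing B‖G‖² leaves (5B+1)‖G‖² ≤ C.
  have h2 : (Fintype.card ι : ℝ) * ((6 * B + 1) * ‖G‖ ^ 2) ≤
      Fintype.card ι * (B * ‖G‖ ^ 2 + C) := by
    refine le_of_mul_le_mul_left ?_ hN
    calc _ = (6 * B + 1) * (Fintype.card ι * ‖G‖) ^ 2 := by ring
      _ ≤ (6 * B + 1) * (Z.card * ((B * ‖G‖ ^ 2 + C) * Fintype.card ι)) := by gcongr
      _ = (Z.card * (6 * B + 1)) * ((B * ‖G‖ ^ 2 + C) * Fintype.card ι) := by ring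
      _ ≤ Fintype.card ι * ((B * ‖G‖ ^ 2 + C) * Fintype.card ι) := by gcongr
      _ = _ := by ring
  have h3 := le_of_mul_le_mul_left h2 hN
  rw [le_div_iff₀ (by positivity)]
  nlinarith [sq_nonneg ‖G‖]

end EmpiricalLoss

/-! ### Expectations under discrete laws. -/

section Expectation

open scoped ENNReal

variable {α β : Type*}

lemma tsum_bind_mul (p : PMF α) (k : α → PMF β) (f : β → ℝ≥0∞) :
    ∑' y, p.bind k y * f y = ∑' x, p x * ∑' y, k x y * f y := by
  simp_rw [PMF.bind_apply, ← ENNReal.tsum_mul_right, ← ENNReal.tsum_mul_left]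
  rw [ENNReal.tsum_comm]
  simp_rw [mul_assoc]

lemma tsum_pure_mul (a : α) (f : β → ℝ≥0∞) (g : α → β) :
    ∑' y, PMF.pure (g a) y * f y = f (g a) := by
  rw [tsum_eq_single (g a) fun y hy => by rw [PMF.pure_apply_of_ne _ _ hy, zero_mul],
    PMF.pure_apply_self, one_mul]

lemma tsum_map_mul (p : PMF α) (g : α → β) (f : β → ℝ≥0∞) :
    ∑' y, p.map g y * f y = ∑' x, p x * f (g x) := by
  rw [PMF.map, tsum_bind_mul]
  exact tsum_congr fun x => by rw [Function.comp_apply, tsum_pure_mul]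

variable {d : ℕ}

lemma meanSqDist_pure (θ c : Param d) :
    meanSqDist (PMF.pure θ) c = ENNReal.ofReal (‖θ - c‖ ^ 2) :=
  tsum_pure_mul θ _ id

/-- The tower rule: an affine bound conditional on the current point survives averaging. It serves
both single steps and the whole unlearning phase. -/
lemma meanSqDist_bind_le {p : PMF (Param d)} {k : Param d → PMF (Param d)} {c c' : Param d}
    {a e x : ℝ} (ha : 0 ≤ a) (he : 0 ≤ e) (hx : 0 ≤ x)
    (hp : meanSqDist p c ≤ ENNReal.ofReal x)
    (hk : ∀ θ, meanSqDist (k θ) c' ≤ ENNReal.ofReal (a * ‖θ - c‖ ^ 2 + e)) :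
    meanSqDist (p.bind k) c' ≤ ENNReal.ofReal (a * x + e) := by
  rw [meanSqDist, tsum_bind_mul]
  calc _ ≤ ∑' θ, (ENNReal.ofReal a * (p θ * ENNReal.ofReal (‖θ - c‖ ^ 2)) +
        p θ * ENNReal.ofReal e) := by
        refine ENNReal.tsum_le_tsum fun θ => ?_
        calc _ ≤ p θ * _ := mul_le_mul_right (hk θ) _
          _ = _ := by
            rw [ENNReal.ofReal_add (by positivity) he, ENNReal.ofReal_mul ha]
            ring
    _ = ENNReal.ofReal a * meanSqDist p c + ENNReal.ofReal e := by
        rw [ENNReal.tsum_add, ENNReal.tsum_mul_left, ENNReal.tsum_mul_right, p.tsum_coe, one_mul,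
          meanSqDist]
    _ ≤ ENNReal.ofReal a * ENNReal.ofReal x + ENNReal.ofReal e := by gcongr
    _ = _ := by rw [ENNReal.ofReal_add (by positivity) he, ENNReal.ofReal_mul ha]

lemma meanSqDist_change_center {p : PMF (Param d)} {c : Param d} {x : ℝ} (hx : 0 ≤ x)
    (hp : meanSqDist p c ≤ ENNReal.ofReal x) (c' : Param d) :
    meanSqDist p c' ≤ ENNReal.ofReal (5 / 4 * x + 5 * ‖c - c'‖ ^ 2) := by
  rw [← p.bind_pure]
  refine meanSqDist_bind_le (by norm_num) (by positivity) hx hp fun θ => ?_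
  rw [meanSqDist_pure]
  refine ENNReal.ofReal_le_ofReal ?_
  have h1 := norm_sub_le_norm_sub_add_norm_sub θ c c'
  have := norm_nonneg (θ - c')
  -- Young's inequality 2uv ≤ u²/4 + 4v² produces the weights 5/4 and 5.
  nlinarith [sq_nonneg (‖θ - c‖ / 2 - 2 * ‖c - c'‖)]

end Expectation

/-! ### Mini-batch moments and convergence of SGD. -/

section Sampling

variable {ι : Type} [Fintype ι] {b : ℕ}

/-- Each coordinate of a uniform batch is uniform. The extra factor on the left avoids the exponent
b - 1. -/
lemma card_smul_sum_pi_apply {M : Type*} [AddCommMonoid M] (f : ι → M) (j : Fin b) :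
    Fintype.card ι • ∑ β : Fin b → ι, f (β j) = Fintype.card ι ^ b • ∑ i, f i := by
  classical
  rw [Fintype.sum_equiv (Equiv.funSplitAt j ι) (fun β => f (β j)) (fun x => f x.1)
    (fun _ => rfl), Fintype.sum_prod_type]
  simp only [Finset.sum_const, Finset.card_univ, ← Finset.smul_sum, smul_smul]
  congr 1
  obtain ⟨b, rfl⟩ : ∃ b', b = b' + 1 := ⟨b - 1, (Nat.succ_pred_eq_of_pos j.pos).symm⟩
  simp [Fintype.card_subtype_compl, pow_succ']

variable {𝒵 : Type*} {d : ℕ} {ℓ : 𝒵 → Param d → ℝ} [Nonempty ι] {L μ B C η : ℝ}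

lemma sum_batchGradient (hℓ : ∀ z, Differentiable ℝ (ℓ z)) (hb : 0 < b) (D : ι → 𝒵)
    (θ : Param d) :
    ∑ β : Fin b → ι, batchGradient ℓ D β θ =
      (Fintype.card ι : ℝ) ^ b • gradient (empiricalLoss ℓ D) θ := by
  have hN : (0 : ℝ) < Fintype.card ι := by exact_mod_cast Fintype.card_pos
  have hb' : (b : ℝ) ≠ 0 := by exact_mod_cast hb.ne'
  have h : ∀ j : Fin b, ∑ β : Fin b → ι, gradient (ℓ (D (β j))) θ =
      (Fintype.card ι : ℝ) ^ b • gradient (empiricalLoss ℓ D) θ := by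
    intro j
    have h := card_smul_sum_pi_apply (fun i => gradient (ℓ (D i)) θ) j
    rw [← Nat.cast_smul_eq_nsmul ℝ, ← Nat.cast_smul_eq_nsmul ℝ, Nat.cast_pow] at h
    rw [gradient_empiricalLoss hℓ, smul_comm, ← h, inv_smul_smul₀ hN.ne']
  simp only [batchGradient]
  rw [← Finset.smul_sum, Finset.sum_comm, Finset.sum_congr rfl fun j _ => h j, Finset.sum_const,
    Finset.card_univ, Fintype.card_fin, ← Nat.cast_smul_eq_nsmul ℝ, inv_smul_smul₀ hb']

/-- By convexity of the squared norm, averaging over a batch does not increase the single-sample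
bound; only the marginals matter. -/
lemma sum_norm_batchGradient_sq_le (hmoment : HasRelativeSecondMoment ℓ B C) (hb : 0 < b)
    (D : ι → 𝒵) (θ : Param d) :
    ∑ β : Fin b → ι, ‖batchGradient ℓ D β θ‖ ^ 2 ≤
      (Fintype.card ι : ℝ) ^ b * (B * ‖gradient (empiricalLoss ℓ D) θ‖ ^ 2 + C) := by
  have hN : (0 : ℝ) < Fintype.card ι := by exact_mod_cast Fintype.card_pos
  have hb' : (0 : ℝ) < b := by exact_mod_cast hb
  have h1 : ∀ β : Fin b → ι, ‖batchGradient ℓ D β θ‖ ^ 2 ≤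
      (b : ℝ)⁻¹ * ∑ j, ‖gradient (ℓ (D (β j))) θ‖ ^ 2 := by
    intro β
    rw [batchGradient, norm_smul, mul_pow, norm_inv, Real.norm_of_nonneg hb'.le]
    calc _ ≤ ((b : ℝ)⁻¹) ^ 2 * (∑ j, ‖gradient (ℓ (D (β j))) θ‖) ^ 2 := by
          gcongr
          exact norm_sum_le _ _
      _ ≤ ((b : ℝ)⁻¹) ^ 2 * (b * ∑ j, ‖gradient (ℓ (D (β j))) θ‖ ^ 2) := by
          gcongr
          simpa using sq_sum_le_card_mul_sum_sq (s := Finset.univ)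
            (f := fun j => ‖gradient (ℓ (D (β j))) θ‖)
      _ = _ := by field_simp
  have h2 : ∀ j : Fin b, ∑ β : Fin b → ι, ‖gradient (ℓ (D (β j))) θ‖ ^ 2 ≤
      (Fintype.card ι : ℝ) ^ b * (B * ‖gradient (empiricalLoss ℓ D) θ‖ ^ 2 + C) := by
    intro j
    have h := card_smul_sum_pi_apply (fun i => ‖gradient (ℓ (D i)) θ‖ ^ 2) j
    rw [nsmul_eq_mul, nsmul_eq_mul, Nat.cast_pow] at h
    have hm := hmoment ι D θ
    rw [div_le_iff₀ hN] at hm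
    refine le_of_mul_le_mul_left ?_ hN
    calc _ = _ := h
      _ ≤ (Fintype.card ι : ℝ) ^ b *
          ((B * ‖gradient (empiricalLoss ℓ D) θ‖ ^ 2 + C) * Fintype.card ι) := by gcongr
      _ = _ := by ring
  calc _ ≤ ∑ β : Fin b → ι, (b : ℝ)⁻¹ * ∑ j, ‖gradient (ℓ (D (β j))) θ‖ ^ 2 :=
        Finset.sum_le_sum fun β _ => h1 β
    _ = (b : ℝ)⁻¹ * ∑ j, ∑ β : Fin b → ι, ‖gradient (ℓ (D (β j))) θ‖ ^ 2 := by
        rw [← Finset.mul_sum, Finset.sum_comm]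
    _ ≤ (b : ℝ)⁻¹ * ∑ _j : Fin b, ((Fintype.card ι : ℝ) ^ b *
          (B * ‖gradient (empiricalLoss ℓ D) θ‖ ^ 2 + C)) := by
        gcongr with j
        exact h2 j
    _ = _ := by
        rw [Finset.sum_const, Finset.card_univ, Fintype.card_fin, nsmul_eq_mul]
        field_simp

variable (hL0 : 0 < L) (hB : 0 < B) (hC : 0 < C) (hη : 0 < η)
  (hηBL : η * (B * L) ≤ 1) (hημ : η * μ ≤ 1) (hb : 0 < b)
  (hsmooth : IsSmoothLoss ℓ L) (hconvex : IsStronglyConvexLoss ℓ μ)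
  (hmoment : HasRelativeSecondMoment ℓ B C) (D : ι → 𝒵) {c : Param d}
  (hc : ∀ θ, empiricalLoss ℓ D c ≤ empiricalLoss ℓ D θ)

include hL0 hB hη hηBL hb hsmooth hconvex hmoment hc in
-- In the expanded square, strong convexity makes the cross term supply -2η times the optimality
-- gap. Smoothness and ηBL ≤ 1 bound η²B‖G‖² by 2η times the same gap, so the two cancel.
lemma sum_norm_sgd_update_sub_sq_le (θ : Param d) :
    ∑ β : Fin b → ι, ‖θ - η • batchGradient ℓ D β θ - c‖ ^ 2 ≤
      (Fintype.card ι : ℝ) ^ b * ((1 - η * μ) * ‖θ - c‖ ^ 2 + η ^ 2 * C) := by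
  have hℓ := fun z => (hsmooth z).1
  have hF := hsmooth.empiricalLoss D
  have hN : (0 : ℝ) < (Fintype.card ι : ℝ) ^ b := by
    have : (0 : ℝ) < Fintype.card ι := by exact_mod_cast Fintype.card_pos
    positivity
  have hexpand : ∀ β : Fin b → ι, ‖θ - η • batchGradient ℓ D β θ - c‖ ^ 2 =
      ‖θ - c‖ ^ 2 - 2 * η * inner ℝ (θ - c) (batchGradient ℓ D β θ) +
        η ^ 2 * ‖batchGradient ℓ D β θ‖ ^ 2 := by
    intro β
    rw [sub_right_comm, norm_sub_sq_real, real_inner_smul_right, norm_smul, mul_pow,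
      Real.norm_eq_abs, sq_abs]
    ring
  have h1 := norm_gradient_sq_le hL0 hF.1 hF.2 hc θ
  have h2 := hconvex.empiricalLoss hℓ D c θ
  have h3 := sum_norm_batchGradient_sq_le hmoment hb D θ
  set G := gradient (empiricalLoss ℓ D) θ with hG
  rw [← neg_sub θ c, inner_neg_right, real_inner_comm] at h2
  have h4 : η ^ 2 * B * ‖G‖ ^ 2 ≤ 2 * η * (empiricalLoss ℓ D θ - empiricalLoss ℓ D c) := by
    calc _ ≤ η ^ 2 * B * (2 * L * (empiricalLoss ℓ D θ - empiricalLoss ℓ D c)) := by gcongr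
      _ = 2 * η * (empiricalLoss ℓ D θ - empiricalLoss ℓ D c) * (η * (B * L)) := by ring
      _ ≤ 2 * η * (empiricalLoss ℓ D θ - empiricalLoss ℓ D c) * 1 := by
          have := sub_nonneg.2 (hc θ)
          gcongr
      _ = _ := mul_one _
  calc _ = (Fintype.card ι : ℝ) ^ b * ‖θ - c‖ ^ 2 -
        2 * η * ((Fintype.card ι : ℝ) ^ b * inner ℝ (θ - c) G) +
          η ^ 2 * ∑ β : Fin b → ι, ‖batchGradient ℓ D β θ‖ ^ 2 := by
        rw [Finset.sum_congr rfl fun β _ => hexpand β, Finset.sum_add_distrib,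
          Finset.sum_sub_distrib, ← Finset.mul_sum, ← Finset.mul_sum, ← inner_sum,
          sum_batchGradient hℓ hb, real_inner_smul_right]
        simp [hG]
    _ ≤ (Fintype.card ι : ℝ) ^ b * ‖θ - c‖ ^ 2 -
        2 * η * ((Fintype.card ι : ℝ) ^ b * inner ℝ (θ - c) G) +
          η ^ 2 * ((Fintype.card ι : ℝ) ^ b * (B * ‖G‖ ^ 2 + C)) := by gcongr
    _ = (Fintype.card ι : ℝ) ^ b * (‖θ - c‖ ^ 2 - 2 * η * inner ℝ (θ - c) G +
          η ^ 2 * B * ‖G‖ ^ 2 + η ^ 2 * C) := by ring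
    _ ≤ _ := by
        gcongr
        have := mul_le_mul_of_nonneg_left h2 (by positivity : 0 ≤ 2 * η)
        linarith

include hL0 hB hη hηBL hb hsmooth hconvex hmoment hc in
lemma meanSqDist_sgdStep_le (θ : Param d) :
    meanSqDist (sgdStep ℓ η b D θ) c ≤
      ENNReal.ofReal ((1 - η * μ) * ‖θ - c‖ ^ 2 + η ^ 2 * C) := by
  have hN : (0 : ℝ) < (Fintype.card ι : ℝ) ^ b := by
    have : (0 : ℝ) < Fintype.card ι := by exact_mod_cast Fintype.card_pos
    positivity
  have hcard : ((Fintype.card (Fin b → ι) : ENNReal))⁻¹ =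
      ENNReal.ofReal ((Fintype.card ι : ℝ) ^ b)⁻¹ := by
    rw [ENNReal.ofReal_inv_of_pos hN, ← Nat.cast_pow, ENNReal.ofReal_natCast, Fintype.card_fun,
      Fintype.card_fin]
  rw [meanSqDist, sgdStep, tsum_map_mul, tsum_fintype]
  simp only [PMF.uniformOfFintype_apply, hcard]
  rw [← Finset.mul_sum, ← ENNReal.ofReal_sum_of_nonneg fun _ _ => by positivity,
    ← ENNReal.ofReal_mul (by positivity)]
  refine ENNReal.ofReal_le_ofReal ?_
  rw [inv_mul_le_iff₀ hN]
  exact sum_norm_sgd_update_sub_sq_le hL0 hB hη hηBL hb hsmooth hconvex hmoment D hc θ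

include hL0 hB hC hη hηBL hημ hb hsmooth hconvex hmoment hc in
/-- Linear convergence of SGD to a neighbourhood of the minimizer of the empirical loss. -/
lemma meanSqDist_sgd_le (hμ : 0 < μ) (θ : Param d) (t : ℕ) :
    meanSqDist (sgd ℓ η b D θ t) c ≤
      ENNReal.ofReal ((1 - η * μ) ^ t * ‖θ - c‖ ^ 2 +
        (1 - (1 - η * μ) ^ t) * (η * C / μ)) := by
  have hr0 : 0 ≤ 1 - η * μ := by linarith
  have hr1 : 1 - η * μ ≤ 1 := by nlinarith
  -- The recursion r ↦ (1 - ημ)r + η²C has fixed point ηC/μ.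
  induction t with
  | zero => simp [sgd, meanSqDist_pure]
  | succ t ih =>
    have h1 : 0 ≤ 1 - (1 - η * μ) ^ t := sub_nonneg.2 (pow_le_one₀ hr0 hr1)
    refine (meanSqDist_bind_le hr0 (by positivity) (by positivity) ih
      (meanSqDist_sgdStep_le hL0 hB hη hηBL hb hsmooth hconvex hmoment D hc)).trans
      (le_of_eq ?_)
    congr 1
    field_simp
    ring

end Sampling

/-! ### Relations between the constants. -/

section Constants

variable {𝒵 : Type*} {d : ℕ} {ℓ : 𝒵 → Param d → ℝ} {L μ B C : ℝ}

lemma strongConvexity_le_smoothness [Nontrivial (Param d)] (z : 𝒵) (hsmooth : IsSmoothLoss ℓ L)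
    (hconvex : IsStronglyConvexLoss ℓ μ) : μ ≤ L := by
  obtain ⟨x, y, hxy⟩ := exists_pair_ne (Param d)
  refine le_of_mul_le_mul_right ?_ (norm_pos_iff.2 (sub_ne_zero.2 hxy))
  exact (mul_norm_sub_le_norm_gradient_sub (hconvex z) x y).trans ((hsmooth z).2 x y)

/-- The gradients of a strongly convex loss are unbounded, so the relative second-moment bound on
a dataset with one sample forces `1 ≤ B`. -/
lemma HasRelativeSecondMoment.one_le [Nontrivial (Param d)] (z : 𝒵) (hμ : 0 < μ) (hC : 0 < C)
    (hsmooth : IsSmoothLoss ℓ L) (hconvex : IsStronglyConvexLoss ℓ μ)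
    (hmoment : HasRelativeSecondMoment ℓ B C) : 1 ≤ B := by
  by_contra! hB
  have hB' : 0 < 1 - B := by linarith
  obtain ⟨c, hc⟩ := exists_forall_le_of_strongly_convex hμ (hsmooth z).1 (hconvex z)
  have hc0 := gradient_eq_zero_of_forall_le hc
  -- At this radius (1 - B)μ²‖v‖² = C + 1, exceeding the C that the moment bound allows.
  obtain ⟨v, hv⟩ := exists_norm_eq (Param d)
    (Real.sqrt_nonneg ((C + 1) / ((1 - B) * μ ^ 2)))
  have h1 := mul_norm_sub_le_norm_gradient_sub (hconvex z) (c + v) c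
  rw [add_sub_cancel_left, hc0, sub_zero, hv] at h1
  have h2 := hmoment Unit (fun _ => z) (c + v)
  rw [gradient_empiricalLoss fun z => (hsmooth z).1] at h2
  simp only [Finset.univ_unique, Finset.sum_singleton, Fintype.card_unit, Nat.cast_one, div_one,
    inv_one, one_smul] at h2
  have h3 := pow_le_pow_left₀ (by positivity) h1 2
  rw [mul_pow, Real.sq_sqrt (by positivity)] at h3
  have h4 : (1 - B) * (μ ^ 2 * ((C + 1) / ((1 - B) * μ ^ 2))) = C + 1 := by field_simp
  have h5 := mul_le_mul_of_nonneg_left h3 hB'.le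
  linarith

/-- This is the condition on T in exponentiated form. -/
lemma pow_mul_le_of_log_le {a A q : ℝ} {K T : ℕ} (ha : 0 < a) (hA : 0 < A) (hq : 0 < q)
    (hq1 : q < 1) (h : (K : ℝ) + (Real.log a - Real.log A) / Real.log (1 / q) ≤ T) :
    q ^ T * a ≤ q ^ K * A := by
  have hlog : Real.log (1 / q) = -Real.log q := by rw [one_div, Real.log_inv]
  have hneg : 0 < -Real.log q := by linarith [Real.log_neg hq hq1]
  rw [← le_sub_iff_add_le', hlog, div_le_iff₀ hneg] at h
  rw [← Real.log_le_log_iff (by positivity) (by positivity), Real.log_mul (by positivity) ha.ne',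
    Real.log_mul (by positivity) hA.ne', Real.log_pow, Real.log_pow]
  linarith

end Constants

/-! ### Distances of the learned and unlearned models to the retained minimizer. -/

section Unlearning

variable {𝒵 : Type*} {d : ℕ} {ℓ : 𝒵 → Param d → ℝ} {θ₀ : Param d} {L μ B C ℓ₀ η : ℝ} {b : ℕ}

lemma empiricalLoss_bounds {ι : Type} [Fintype ι] [Nonempty ι] (hinit : HasBoundedInit ℓ θ₀ ℓ₀)
    (D : ι → 𝒵) : (∀ θ, 0 ≤ empiricalLoss ℓ D θ) ∧ empiricalLoss ℓ D θ₀ ≤ ℓ₀ := by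
  have hN : (0 : ℝ) < Fintype.card ι := by exact_mod_cast Fintype.card_pos
  refine ⟨fun θ => div_nonneg (Finset.sum_nonneg fun i _ => hinit.1 _ _) hN.le, ?_⟩
  rw [empiricalLoss, div_le_iff₀ hN]
  refine (Finset.sum_le_sum fun i _ => hinit.2 (D i)).trans (le_of_eq ?_)
  simp [mul_comm]

lemma norm_init_sub_sq_le {ι : Type} [Fintype ι] [Nonempty ι] (hμ : 0 < μ)
    (hℓ : ∀ z, Differentiable ℝ (ℓ z)) (hconvex : IsStronglyConvexLoss ℓ μ)
    (hinit : HasBoundedInit ℓ θ₀ ℓ₀) (D : ι → 𝒵) {c : Param d}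
    (hc : gradient (empiricalLoss ℓ D) c = 0) : ‖θ₀ - c‖ ^ 2 ≤ 2 * ℓ₀ / μ := by
  have h := hconvex.empiricalLoss hℓ D θ₀ c
  obtain ⟨h0, h1⟩ := empiricalLoss_bounds hinit D
  rw [hc, inner_zero_left, norm_sub_rev] at h
  rw [le_div_iff₀ hμ]
  linarith [h0 c]

variable (hL0 : 0 < L) (hμ : 0 < μ) (hB : 0 < B) (hC : 0 < C) (hℓ₀ : 0 < ℓ₀) (hη : 0 < η)
  (hηBL : η * (B * L) ≤ 1) (hημ : η * μ ≤ 1) (hb : 0 < b)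
  (hsmooth : IsSmoothLoss ℓ L) (hconvex : IsStronglyConvexLoss ℓ μ)
  (hmoment : HasRelativeSecondMoment ℓ B C) (hinit : HasBoundedInit ℓ θ₀ ℓ₀) {K T : ℕ}
  (hT : (K : ℝ) + (Real.log ℓ₀ - Real.log (5 * C / (4 * B * μ)))
        / Real.log (1 / (1 - η * μ / 2)) ≤ T)

include hL0 hμ hB hC hℓ₀ hη hηBL hημ hb hsmooth hconvex hmoment hinit hT in
/-- The accuracy of the learned model. -/
lemma meanSqDist_learned_le {ι : Type} [Fintype ι] [Nonempty ι] (D : ι → 𝒵) {c : Param d}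
    (hc : ∀ θ, empiricalLoss ℓ D c ≤ empiricalLoss ℓ D θ) :
    meanSqDist (sgd ℓ η b D θ₀ T) c ≤
      ENNReal.ofReal ((1 - η * μ / 2) ^ K * (5 / 2 * (C / (B * μ ^ 2))) + η * C / μ) := by
  have hημ0 : 0 < η * μ := mul_pos hη hμ
  have hr0 : 0 ≤ 1 - η * μ := by linarith
  have hq0 : 0 ≤ 1 - η * μ / 2 := by linarith
  refine (meanSqDist_sgd_le hL0 hB hC hη hηBL hημ hb hsmooth hconvex hmoment D hc hμ θ₀ T).trans
    (ENNReal.ofReal_le_ofReal ?_)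
  have h1 := norm_init_sub_sq_le hμ (fun z => (hsmooth z).1) hconvex hinit D
    (gradient_eq_zero_of_forall_le hc)
  have h2 := pow_mul_le_of_log_le hℓ₀ (by positivity) (by linarith) (by linarith) hT
  have he : 0 ≤ η * C / μ := by positivity
  have hrT : 0 ≤ (1 - η * μ) ^ T := by positivity
  -- SGD contracts at rate 1 - ημ, which is at most the rate 1 - ημ/2 in the condition on T.
  have h3 : (1 - η * μ) ^ T * ‖θ₀ - c‖ ^ 2 ≤
      (1 - η * μ / 2) ^ K * (5 / 2 * (C / (B * μ ^ 2))) := by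
    calc _ ≤ (1 - η * μ / 2) ^ T * (2 * ℓ₀ / μ) := by
          gcongr
          linarith
      _ = (1 - η * μ / 2) ^ T * ℓ₀ * (2 / μ) := by ring
      _ ≤ (1 - η * μ / 2) ^ K * (5 * C / (4 * B * μ)) * (2 / μ) := by gcongr
      _ = _ := by
        field_simp
        ring
  nlinarith

include hL0 hμ hB hC hℓ₀ hη hηBL hημ hb hsmooth hconvex hmoment hinit hT in
/-- The learned model on `D`, after `K` unlearning steps, and the model learned on the retained
dataset are both close to the minimizer of the loss on the retained dataset. -/
lemma exists_meanSqDist_add_le (hμL : μ ≤ L) {ι : Type} [Fintype ι] [DecidableEq ι] [Nonempty ι]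
    (D : ι → 𝒵) (Z : Finset ι) [Nonempty {i // i ∉ Z}]
    (hZ : (Z.card : ℝ) / Fintype.card ι < 1 / (6 * B + 1)) :
    ∃ c, 2 * (meanSqDist ((sgd ℓ η b D θ₀ T).bind fun θT => sgd ℓ η b (retained D Z) θT K) c +
        meanSqDist (sgd ℓ η b (retained D Z) θ₀ T) c) ≤
      ENNReal.ofReal (5 * C / (μ ^ 2 * B)
        * ((1 - η * μ / 2) ^ (2 * K) + 2 * (1 - η * μ / 2) ^ K) + 4 * L * η * C / μ ^ 2) := by
  have hℓ := fun z => (hsmooth z).1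
  have hF := hsmooth.empiricalLoss D
  have hF' := hsmooth.empiricalLoss (retained D Z)
  have hG := hconvex.empiricalLoss hℓ D
  have hG' := hconvex.empiricalLoss hℓ (retained D Z)
  obtain ⟨c, hc⟩ := exists_forall_le_of_strongly_convex hμ hF.1 hG
  obtain ⟨c', hc'⟩ := exists_forall_le_of_strongly_convex hμ hF'.1 hG'
  refine ⟨c', ?_⟩
  set U := C / (B * μ ^ 2) with hU
  set e := η * C / μ with he
  set Q := (1 - η * μ / 2) ^ K with hQ
  set R := (1 - η * μ) ^ K with hR
  have hημ0 : 0 < η * μ := mul_pos hη hμ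
  have hr0 : 0 ≤ 1 - η * μ := by linarith
  have hq0 : 0 < 1 - η * μ / 2 := by linarith
  have hU0 : 0 < U := by positivity
  have he0 : 0 < e := by positivity
  have hQ0 : 0 < Q := by positivity
  have hQ1 : Q ≤ 1 := pow_le_one₀ hq0.le (by linarith)
  have hR0 : 0 ≤ R := by positivity
  -- Since 1 - ημ ≤ (1 - ημ/2)², unlearning gains the factor `Q ^ 2` behind the exponent 2K in Σ².
  have hRQ : R ≤ Q ^ 2 := by
    rw [hR, hQ, ← pow_mul, mul_comm K 2, pow_mul]
    gcongr
    nlinarith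
  have hR1 : R ≤ 1 := pow_le_one₀ hr0 (by linarith)
  have heU : e ≤ U := by
    have h : e = U * (η * (B * μ)) := by rw [he, hU]; field_simp
    rw [h]
    refine mul_le_of_le_one_right hU0.le (le_trans ?_ hηBL)
    gcongr
  have heL : 4 * e ≤ 4 * L * η * C / μ ^ 2 := by
    have h : 4 * e = 4 * μ * η * C / μ ^ 2 := by rw [he]; field_simp
    rw [h]
    gcongr
  have hcc : ‖c - c'‖ ^ 2 ≤ U / 5 := by
    have h1 := norm_gradient_sq_le_of_retained hB hC hℓ hmoment D Z hZ
      (gradient_eq_zero_of_forall_le hc')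
    have h2 := mul_norm_sub_le_norm_gradient_sub hG c' c
    rw [gradient_eq_zero_of_forall_le hc, sub_zero, norm_sub_rev] at h2
    have h3 := (pow_le_pow_left₀ (by positivity) h2 2).trans h1
    rw [mul_pow] at h3
    calc ‖c - c'‖ ^ 2 = μ ^ 2 * ‖c - c'‖ ^ 2 / μ ^ 2 := by field_simp
      _ ≤ C / (5 * B) / μ ^ 2 := by gcongr
      _ = U / 5 := by rw [hU]; field_simp
  have h1 := meanSqDist_change_center (by positivity)
    (meanSqDist_learned_le hL0 hμ hB hC hℓ₀ hη hηBL hημ hb hsmooth hconvex hmoment hinit hT D hc) c'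
  have h2 := meanSqDist_learned_le hL0 hμ hB hC hℓ₀ hη hηBL hημ hb hsmooth hconvex hmoment hinit
    hT (retained D Z) hc'
  have h3 := meanSqDist_bind_le hR0 (mul_nonneg (sub_nonneg.2 hR1) he0.le) (by positivity) h1
    fun θ => meanSqDist_sgd_le hL0 hB hC hη hηBL hημ hb hsmooth hconvex hmoment (retained D Z) hc'
      hμ θ K
  calc _ ≤ 2 * (ENNReal.ofReal (R * (5 / 4 * (Q * (5 / 2 * U) + e) + 5 * ‖c - c'‖ ^ 2) +
          (1 - R) * e) + ENNReal.ofReal (Q * (5 / 2 * U) + e)) := by gcongr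
    _ = ENNReal.ofReal (2 * (R * (5 / 4 * (Q * (5 / 2 * U) + e) + 5 * ‖c - c'‖ ^ 2) +
          (1 - R) * e + (Q * (5 / 2 * U) + e))) := by
        rw [← ENNReal.ofReal_add, ENNReal.ofReal_mul (by norm_num), ENNReal.ofReal_ofNat]
        · have := mul_nonneg (sub_nonneg.2 hR1) he0.le
          positivity
        · positivity
    _ ≤ _ := by
        refine ENNReal.ofReal_le_ofReal ?_
        have e1 : 5 * C / (μ ^ 2 * B) = 5 * U := by rw [hU]; field_simp
        have e2 : (1 - η * μ / 2) ^ (2 * K) = Q ^ 2 := by rw [hQ, ← pow_mul, mul_comm K 2]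
        rw [e1, e2]
        have hQU : Q * U ≤ U := mul_le_of_le_one_left hU0.le hQ1
        -- 25/8 + 1/4 + 1 = 35/8. Doubled, it gives 35/4 = 5 + 15/4 copies of `Q ^ 2 * U`; the
        -- excess 15/4 fits into the 5 copies of `Q * U` left over by the relearned model.
        have k1 : 25 / 8 * (Q * U) + e / 4 + 5 * ‖c - c'‖ ^ 2 ≤ 35 / 8 * U := by linarith
        have k2 := mul_le_mul hRQ k1 (by positivity) (by positivity)
        have hQU0 : 0 < Q * U := mul_pos hQ0 hU0
        have k3 : Q ^ 2 * U ≤ Q * U := by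
          gcongr
          nlinarith
        calc _ = 2 * (R * (25 / 8 * (Q * U) + e / 4 + 5 * ‖c - c'‖ ^ 2)) + 5 * (Q * U) +
              4 * e := by ring
          _ ≤ 5 * (Q ^ 2 * U) + 10 * (Q * U) + 4 * L * η * C / μ ^ 2 := by linarith
          _ = _ := by ring

end Unlearning

lemma indistinguishable_of_subsingleton {Θ : Type*} [MeasurableSpace Θ] [Subsingleton Θ]
    (P Q : Measure Θ) [IsProbabilityMeasure P] [IsProbabilityMeasure Q] {ε δ : ℝ} (hε : 0 ≤ ε) :
    Indistinguishable ε δ P Q := by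
  have hPQ : P = Q := by
    ext S _
    rcases S.eq_empty_or_nonempty with rfl | hS
    · simp
    · simp [Subsingleton.eq_univ_of_nonempty hS]
  subst hPQ
  have h : ∀ S, P S ≤ ENNReal.ofReal (Real.exp ε) * P S + ENNReal.ofReal δ := fun S =>
    (le_mul_of_one_le_left' (by simpa using hε)).trans le_self_add
  exact fun S _ => ⟨h S, h S⟩

instance isProbabilityMeasure_addGaussianNoise {d : ℕ} (σ : ℝ) (p : PMF (Param d)) :
    IsProbabilityMeasure (addGaussianNoise σ p) := by
  have : IsProbabilityMeasure ((stdGaussian (Param d)).map fun x => σ • x) :=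
    Measure.isProbabilityMeasure_map (by fun_prop)
  unfold addGaussianNoise
  infer_instance

end D2D

theorem theorem3 {𝒵 : Type*} {d : ℕ} (ℓ : 𝒵 → D2D.Param d → ℝ) (θ₀ : D2D.Param d)
    (L μ B C ℓ₀ η ε δ Sig σ : ℝ) (b n m K T : ℕ) [NeZero n]
    (hL : 0 < L) (hμ : 0 < μ) (hB : 0 < B) (hC : 0 < C) (hℓ₀ : 0 < ℓ₀) (hb : 0 < b)
    (hsmooth : D2D.IsSmoothLoss ℓ L)
    (hconvex : D2D.IsStronglyConvexLoss ℓ μ)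
    (hmoment : D2D.HasRelativeSecondMoment ℓ B C)
    (hinit : D2D.HasBoundedInit ℓ θ₀ ℓ₀)
    (hη : 0 < η) (hηBL : η ≤ 1 / (B * L))
    (hmn : (m : ℝ) / n < 1 / (6 * B + 1))
    (hε : 0 < ε) (hε1 : ε ≤ 1) (hδ : 0 < δ) (hδ1 : δ < 1)
    (hT : (K : ℝ) + (Real.log ℓ₀ - Real.log (5 * C / (4 * B * μ)))
        / Real.log (1 / (1 - η * μ / 2)) ≤ T)
    (hSig : 0 ≤ Sig)
    (hSig2 : Sig ^ 2 = 5 * C / (μ ^ 2 * B)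
        * ((1 - η * μ / 2) ^ (2 * K) + 2 * (1 - η * μ / 2) ^ K) + 4 * L * η * C / μ ^ 2)
    (hσ : σ = Sig / ε * Real.sqrt (2 * Real.log (1.25 / δ) / δ))
    (D : Fin n → 𝒵) :
    D2D.IsCertifiedUnlearning ε (2 * δ) m D
      (D2D.learn ℓ η b θ₀ T σ)
      (D2D.learnThenUnlearn ℓ η b θ₀ T K σ D) := by

  intro Z _ hZ
  -- In dimension 0 neither μ ≤ L nor 1 ≤ B need hold, but all output laws coincide.
  rcases Nat.eq_zero_or_pos d with rfl | hd
  · exact D2D.indistinguishable_of_subsingleton (D2D.addGaussianNoise _ _)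
      (D2D.addGaussianNoise _ _) hε.le
  have : NeZero d := ⟨hd.ne'⟩
  have : Nontrivial (D2D.Param d) := inferInstance
  have hμL := D2D.strongConvexity_le_smoothness (D 0) hsmooth hconvex
  have hB1 := hmoment.one_le (D 0) hμ hC hsmooth hconvex
  have hηBL' : η * (B * L) ≤ 1 := by rwa [le_div_iff₀ (by positivity)] at hηBL
  -- From μ ≤ L and 1 ≤ B: ημ ≤ ηBL ≤ 1, so the contraction factor is nonnegative.
  have hημ : η * μ ≤ 1 := by
    refine le_trans ?_ hηBL'
    gcongr
    nlinarith
  have hημ0 : 0 < η * μ := mul_pos hη hμ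
  have hq0 : 0 < 1 - η * μ / 2 := by linarith
  obtain ⟨c, hc⟩ := D2D.exists_meanSqDist_add_le hL hμ hB hC hℓ₀ hη hηBL' hημ hb hsmooth hconvex
    hmoment hinit hT hμL D Z (by rwa [hZ, Fintype.card_fin])
  rw [← hSig2] at hc
  have hSig0 : 0 < Sig := by
    refine lt_of_le_of_ne hSig fun h => ?_
    rw [← h] at hSig2
    have : 0 < 5 * C / (μ ^ 2 * B)
        * ((1 - η * μ / 2) ^ (2 * K) + 2 * (1 - η * μ / 2) ^ K) + 4 * L * η * C / μ ^ 2 := by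
      positivity
    rw [← hSig2] at this
    norm_num at this
  exact D2D.indistinguishable_addGaussianNoise hε hε1 hδ hδ1 hSig0 hσ _ _ c hc
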